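/- Let $p$ be a prime and $k\ge 1$. Let $\mathbb Z_{(p)}$ be the localization of $\mathbb Z$ at the prime ideal $(p)$, let $\mathbb Z_p$ be the ring of $p$-adic integers, and let $T=\mathrm{Th}(\mathbb Z_{(p)}^k,+)$ be the complete first-order theory of the group $\mathbb Z_{(p)}^k$ in the language $\{+\}$. A first-order theory has the Schröder–Bernstein (SB) property if any two of its models, each of which embeds elementarily into the other, are isomorphic. A subgroup $H$ of an abelian group $G$ is pure if whenever $h\in H$, $n\in\mathbb N$ and $nx=h$ is solvable in $G$, it is solvable in $H$; an abelian group is reduced if it has no nonzero divisible subgroup. Then $T$ does not have the SB property. Furthermore, this failure is witnessed by reduced groups: there are reduced abelian groups $A,B$ that are models of $T$, each elementarily embeddable into the other, and not isomorphic. More explicitly, there are two units $\gamma_1,\gamma_2$ of $\mathbb Z_p$ that are algebraically independent over $\mathbb Z$ (equivalently, over $\mathbb Z_{(p)}$). For any two such units, with $e_1,\dots,e_k$ the standard basis of $\mathbb Z_p^k$, let $H_1$ be the smallest pure subgroup of $\mathbb Z_p^k$ containing $\{\gamma_1^i\gamma_2^je_s: i,j\ge 0,\ 1\le s\le k\}$,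 and $H_2$ the smallest pure subgroup of $\mathbb Z_p^k$ containing $\{\gamma_1^i\gamma_2^je_s: i\ge 1,\ j\ge 0,\ 1\le s\le k\}\cup\{e_s:1\le s\le k\}$. Then $H_1$ and $H_2$ are reduced models of $T$, each elementarily embeddable into the other, and not isomorphic. Moreover, if $S_\ell$ denotes the subring of the endomorphism ring of the group $H_\ell$ generated by all injective endomorphisms with pure image, then the centers of $S_1$ and $S_2$ are not isomorphic as rings. -/

import Mathlib

open FirstOrder FirstOrder.Language

namespace SBGroups

/-- Function symbols of the pure language of groups: a single binary symbol `+`. -/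
inductive PlusFunc : ℕ → Type
  | plus : PlusFunc 2

/-- The pure first-order language of groups, `{+}`. -/
def plusLang : Language where
  Functions := PlusFunc
  Relations := fun _ => Empty

/-- Every type with an addition is a structure for the language `{+}`. -/
instance plusStructure (M : Type*) [Add M] : plusLang.Structure M where
  funMap := fun {_} f => match f with
    | PlusFunc.plus => fun v => v 0 + v 1
  RelMap := fun r => Empty.elim r

/-- The pair of `L`-structures `M`, `N` witnesses that the theory `T` fails the
Schröder–Bernstein property: both are models of `T`, each embeds elementarily into the other,
and they are not isomorphic. -/
structure IsSBCounterexample {L : Language} (T : L.Theory) (M N : Type*)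
    [L.Structure M] [L.Structure N] : Prop where
  left_model : M ⊨ T
  right_model : N ⊨ T
  left_to_right : Nonempty (M ↪ₑ[L] N)
  right_to_left : Nonempty (N ↪ₑ[L] M)
  not_iso : IsEmpty (M ≃[L] N)

/-- The Schröder–Bernstein property of a theory: any two models, each of which embeds
elementarily into the other, are isomorphic. (Models are taken in the lowest universe, so that the
negation provides a counterexample there, hence in every universe.) -/
def HasSB {L : Language} (T : L.Theory) : Prop :=
  ∀ (M N : Type) [L.Structure M] [L.Structure N], M ⊨ T → N ⊨ T →
    Nonempty (M ↪ₑ[L] N) → Nonempty (N ↪ₑ[L] M) → Nonempty (M ≃[L] N)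

section Groups

variable {G : Type*} [AddCommGroup G]

/-- A subgroup that is divisible as a group. -/
def IsDivisibleSubgroup (D : AddSubgroup G) : Prop :=
  ∀ n : ℕ, n ≠ 0 → ∀ d ∈ D, ∃ y ∈ D, n • y = d

variable (G) in
/-- An abelian group is reduced if it has no nonzero divisible subgroup. -/
def IsReducedGroup : Prop :=
  ∀ D : AddSubgroup G, IsDivisibleSubgroup D → D = ⊥

/-- `H` is a pure subgroup of `G`. -/
def IsPureSubgroup (H : AddSubgroup G) : Prop :=
  ∀ n : ℕ, ∀ h ∈ H, (∃ x : G, n • x = h) → ∃ x ∈ H, n • x = h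

/-- The pure hull of `A` in `G`: the intersection of all pure subgroups of `G` containing `A`.
In a torsion-free group it is the smallest pure subgroup containing `A`
(see `isLeast_pureHull`). -/
def pureHull (A : Set G) : AddSubgroup G :=
  sInf {H : AddSubgroup G | IsPureSubgroup H ∧ A ⊆ H}

theorem isLeast_pureHull [IsAddTorsionFree G] (A : Set G) :
    IsLeast {H : AddSubgroup G | IsPureSubgroup H ∧ A ⊆ H} (pureHull A) := by
  refine ⟨⟨?_, ?_⟩, fun H hH => sInf_le hH⟩
  · rintro n h hh ⟨x, hx⟩
    rcases Nat.eq_zero_or_pos n with rfl | hn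
    · exact ⟨0, AddSubgroup.zero_mem _, by simpa using hx⟩
    · refine ⟨x, ?_, hx⟩
      rw [pureHull, AddSubgroup.mem_sInf] at hh ⊢
      intro H hH
      obtain ⟨y, hy, hyx⟩ := hH.1 n h (hh H hH) ⟨x, hx⟩
      have hxy : y = x := nsmul_right_injective hn.ne' (hyx.trans hx.symm)
      exact hxy ▸ hy
  · intro a ha
    exact AddSubgroup.mem_sInf.2 fun H hH => hH.2 ha

variable (G) in
/-- The subring of the endomorphism ring of the abelian group `G` generated by all injective
endomorphisms of `G` with pure image. -/
def pureEndRing : Subring (AddMonoid.End G) :=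
  Subring.closure {f : AddMonoid.End G |
    Function.Injective f ∧ IsPureSubgroup (AddMonoidHom.range (f : G →+ G))}

end Groups

section Local

variable (p : ℕ) [hp : Fact p.Prime]

instance isPrime_span : (Ideal.span {(p : ℤ)}).IsPrime :=
  (Ideal.span_singleton_prime (Nat.cast_ne_zero.2 hp.out.ne_zero)).2
    (Nat.prime_iff_prime_int.1 hp.out)

/-- The ring `ℤ_(p)`, the localization of `ℤ` at the prime ideal `(p)`. -/
abbrev ZLoc : Type := Localization.AtPrime (Ideal.span {(p : ℤ)})

/-- The complete theory of the group `(ℤ_(p)^k, +)`. -/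
def thZLoc (k : ℕ) : plusLang.Theory :=
  plusLang.completeTheory (Fin k → ZLoc p)

variable {p}

/-- The pure hull, in the group `ℤ_p ^ k` of `k`-tuples of `p`-adic integers, of the subgroup
generated by all `γ₁ ^ i * γ₂ ^ j • e_s`, `i, j ≥ 0`. -/
noncomputable def hullOne (k : ℕ) (γ₁ γ₂ : ℤ_[p]) : AddSubgroup (Fin k → ℤ_[p]) :=
  pureHull (AddSubgroup.closure
    {x | ∃ (i j : ℕ) (s : Fin k), x = Pi.single s (γ₁ ^ i * γ₂ ^ j)} : Set (Fin k → ℤ_[p]))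

/-- The pure hull, in the group `ℤ_p ^ k` of `k`-tuples of `p`-adic integers, of the subgroup
generated by all `e_s` and all `γ₁ ^ i * γ₂ ^ j • e_s`, `i ≥ 1`, `j ≥ 0`. -/
noncomputable def hullTwo (k : ℕ) (γ₁ γ₂ : ℤ_[p]) : AddSubgroup (Fin k → ℤ_[p]) :=
  pureHull (AddSubgroup.closure
    ({x | ∃ (i j : ℕ) (s : Fin k), 1 ≤ i ∧ x = Pi.single s (γ₁ ^ i * γ₂ ^ j)} ∪
      {x | ∃ s : Fin k, x = Pi.single s 1}) : Set (Fin k → ℤ_[p]))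

/-- `γ₁`, `γ₂` are units of the ring of `p`-adic integers and algebraically independent over `ℤ`
(equivalently, over `ℤ_(p)` or `ℚ`, by clearing denominators). -/
def IsIndepUnitPair (γ₁ γ₂ : ℤ_[p]) : Prop :=
  IsUnit γ₁ ∧ IsUnit γ₂ ∧ AlgebraicIndependent ℤ ![γ₁, γ₂]

end Local

end SBGroups

/-! Because the generating monomials are closed under multiplication, the two hulls are the groups
of `k`-tuples over two pure subrings of `ℤ_p`: `R₁ = ringOne` consists of the `p`-adic integers in
`ℚ[γ₁, γ₂]`, and `R₂ = ringTwo` of those in `ℚ + γ₁ ℚ[γ₁, γ₂]`. Here `R₂ ⊆ R₁` and `γ₁ R₁ ⊆ R₂`, so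
inclusion and multiplication by `γ₁` embed each group in the other.

These embeddings are elementary because their cokernels are torsion-free (the subrings are pure and
`γ₁` is a unit) and divisible (`ℤ` is dense in `ℤ_p`). `realize_comp_iff_of_pure_of_dense` shows
that this suffices. In an ultrapower every element is an element of the image plus a divisible one;
an automorphism fixing the parameters moves the divisible part into the image, and the Tarski–Vaught
test applies. The same criterion for `ℤ_(p) ⊆ P` makes `P ^ k` a model for every pure subring `P`.

The groups are told apart by recovering `P` from `P ^ k`: it is the centre of the ring generated by
the injective endomorphisms with pure image (`nonempty_center_pureEndRing_equiv`). The rings differ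
because `ℚ[X, Y]` is Noetherian and integrally closed, so up to integer multiples `R₁` contains
every fraction whose powers have a common denominator. In `R₂` the fraction `γ₂ = γ₁γ₂ / γ₁`
violates this, since all `γ₁ γ₂ ^ n` lie in `R₂`. -/

namespace SBGroups

/-- An additive equivalence is an isomorphism of structures for the language `{+}`. -/
def plusEquiv {M N : Type*} [Add M] [Add N] (e : M ≃+ N) : M ≃[plusLang] N where
  toEquiv := e.toEquiv
  map_fun' := fun {_} f v => by cases f; exact map_add e _ _
  map_rel' := fun {_} r => Empty.elim r

/-- An injective additive homomorphism is an embedding of structures for the language `{+}`. -/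
def plusEmbedding {M N : Type*} [AddZeroClass M] [AddZeroClass N] (f : M →+ N)
    (hf : Function.Injective f) : M ↪[plusLang] N where
  toFun := f
  inj' := hf
  map_fun' := fun {_} g v => by cases g; exact map_add f _ _
  map_rel' := fun {_} r => Empty.elim r

/-- An isomorphism of structures for the language `{+}` is an additive equivalence. -/
def addEquivOfPlusEquiv {M N : Type*} [Add M] [Add N] (e : M ≃[plusLang] N) : M ≃+ N where
  toEquiv := e.toEquiv
  map_add' x y := by
    have h := e.map_fun (PlusFunc.plus : plusLang.Functions 2) ![x, y]
    exact h

/-! ### Automorphisms translating by divisible elements -/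

section Transvection

variable {B : Type*} [AddCommGroup B]

theorem exists_nsmul_mem_of_mem_span {W : Type*} [AddCommGroup W] [Module ℚ W] (ι : B →+ W)
    (G : AddSubgroup B) {w : W} (hw : w ∈ Submodule.span ℚ (ι '' G)) :
    ∃ n : ℕ, n ≠ 0 ∧ ∃ g ∈ G, n • w = ι g := by
  induction hw using Submodule.span_induction with
  | mem x hx =>
    obtain ⟨g, hg, rfl⟩ := hx
    exact ⟨1, one_ne_zero, g, hg, one_smul _ _⟩
  | zero => exact ⟨1, one_ne_zero, 0, G.zero_mem, by simp⟩
  | add x y _ _ hx hy =>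
    obtain ⟨m, hm, g, hg, h1⟩ := hx
    obtain ⟨n, hn, g', hg', h2⟩ := hy
    refine ⟨m * n, mul_ne_zero hm hn, n • g + m • g',
      G.add_mem (G.nsmul_mem hg _) (G.nsmul_mem hg' _), ?_⟩
    rw [map_add, map_nsmul, map_nsmul, ← h1, ← h2, smul_add, mul_comm m n, mul_smul, mul_comm n m,
      mul_smul]
  | smul q x _ hx =>
    obtain ⟨m, hm, g, hg, h1⟩ := hx
    refine ⟨q.den * m, mul_ne_zero q.den_nz hm, q.num • g, G.zsmul_mem hg _, ?_⟩
    rw [map_zsmul, ← h1, ← Nat.cast_smul_eq_nsmul ℚ, ← Nat.cast_smul_eq_nsmul ℚ m,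
      ← Int.cast_smul_eq_zsmul ℚ, smul_smul, smul_smul]
    congr 1
    have := Rat.mul_den_eq_num q
    push_cast
    rw [← this]; ring

/-- In a torsion-free group, an element that is independent of a subgroup can be translated by
any divisible element of the subgroup, by an automorphism that fixes the subgroup. -/
theorem exists_transvection [IsAddTorsionFree B] (G : AddSubgroup B) (d e : B)
    (hd : ∀ n : ℕ, n ≠ 0 → n • d ∉ G) (he : e ∈ G) (hdiv : ∀ n : ℕ, n ≠ 0 → ∃ y, n • y = e) :
    ∃ σ : B ≃+ B, (∀ g ∈ G, σ g = g) ∧ σ d = d + e := by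
  let ι : B →+ DivisibleHull B := DivisibleHull.coeAddMonoidHom B
  have hι : Function.Injective ι := DivisibleHull.coe_injective
  have hnot : ι d ∉ Submodule.span ℚ (ι '' G) := by
    intro h
    obtain ⟨n, hn, g, hg, h1⟩ := exists_nsmul_mem_of_mem_span ι G h
    rw [← map_nsmul] at h1
    exact hd n hn (hι h1 ▸ hg)
  -- The map is `x ↦ x + c l(x) e`. It stays in `B` because `e` is divisible, its inverse uses `-c`
  -- because `l` kills `e ∈ G`, and `c = 1 / l(d)` gives `d ↦ d + e`.
  obtain ⟨l, hl, hker⟩ := Submodule.exists_le_ker_of_notMem hnot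
  have hlG : ∀ g ∈ G, l (ι g) = 0 := fun g hg =>
    hker (Submodule.subset_span ⟨g, hg, rfl⟩)
  have hψ : ∀ q : ℚ, ∃ y : B, ι y = q • ι e := by
    intro q
    obtain ⟨y, hy⟩ := hdiv q.den q.den_nz
    refine ⟨q.num • y, ?_⟩
    rw [← hy, map_zsmul, map_nsmul, ← Nat.cast_smul_eq_nsmul ℚ, ← Int.cast_smul_eq_zsmul ℚ,
      smul_smul, Rat.mul_den_eq_num]
  choose ψ hψ using hψ
  let t : ℚ → B →+ B := fun c =>
    { toFun := fun x => x + ψ (c * l (ι x))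
      map_zero' := by
        apply hι
        rw [map_add, hψ]; simp
      map_add' := fun x y => by
        apply hι
        simp only [map_add, hψ, mul_add, add_smul]
        abel }
  have ht : ∀ c x, ι (t c x) = ι x + (c * l (ι x)) • ι e := fun c x => by
    change ι (x + ψ _) = _
    rw [map_add, hψ]
  have hinv : ∀ c x, t (-c) (t c x) = x := by
    intro c x
    apply hι
    simp only [ht, map_add, map_smul, hlG e he, smul_zero, add_zero]
    rw [add_assoc, ← add_smul]
    simp
  let c := (l (ι d))⁻¹
  refine ⟨{ t c with
    invFun := t (-c)
    left_inv := hinv c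
    right_inv := fun x => by simpa using hinv (-c) x }, ?_, ?_⟩
  · intro g hg
    apply hι
    change ι (t c g) = _
    simp [ht, hlG g hg]
  · apply hι
    change ι (t c d) = _
    simp [ht, c, hl]

end Transvection

/-! ### Elementarity when the cokernel is covered by divisible elements -/

section Core

variable {A B : Type*} [AddCommGroup A] [AddCommGroup B]

theorem countable_divisionHull [IsAddTorsionFree A] (G : AddSubgroup A) (hG : (G : Set A).Countable) :
    {c : A | ∃ m : ℕ, m ≠ 0 ∧ m • c ∈ G}.Countable := by
  have : {c : A | ∃ m : ℕ, m ≠ 0 ∧ m • c ∈ G} =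
      ⋃ m : {m : ℕ // m ≠ 0}, (fun c : A => m.1 • c) ⁻¹' G := by
    ext c; simp
  rw [this]
  exact Set.countable_iUnion fun m => hG.preimage (nsmul_right_injective m.2)

/-- Tarski–Vaught: a witness `f α + d` with `d` divisible is moved to `f (α + c)`, with `c`
divisible in `A`, by an automorphism of `B` fixing `α` and the parameters. The hypothesis `hlarge`
provides a `c` independent of these finitely many elements. -/
theorem realize_comp_iff_of_exists_divisible [IsAddTorsionFree B] (f : A →+ B)
    (hf : Function.Injective f)
    (hpure : ∀ n : ℕ, n ≠ 0 → ∀ b, n • b ∈ f.range → b ∈ f.range)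
    (hdense : ∀ b, ∃ a d, b = f a + d ∧ ∀ n : ℕ, n ≠ 0 → ∃ y, n • y = d)
    (hlarge : ∀ C : Set A, C.Countable → ∃ c ∉ C, ∀ n : ℕ, n ≠ 0 → ∃ y, n • y = c)
    {n : ℕ} (φ : plusLang.Formula (Fin n)) (x : Fin n → A) :
    φ.Realize (f ∘ x) ↔ φ.Realize x := by
  have : IsAddTorsionFree A := hf.isAddTorsionFree f
  refine (plusEmbedding f hf).isElementary_of_exists ?_ φ x
  intro n φ x b hb
  obtain ⟨α, d, rfl, hd⟩ := hdense b
  by_cases hdr : d ∈ f.range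
  · obtain ⟨a, rfl⟩ := hdr
    refine ⟨α + a, ?_⟩
    rw [← map_add] at hb
    exact hb
  let F : AddSubgroup A := AddSubgroup.closure (Set.range x ∪ {α})
  have hF : (F : Set A).Countable := by
    refine (Set.countable_range (Finsupp.linearCombination ℤ
      (fun o : Option (Fin n) => o.elim α x))).mono ?_
    have : F ≤ (Finsupp.linearCombination ℤ
        (fun o : Option (Fin n) => o.elim α x)).range.toAddSubgroup := by
      refine (AddSubgroup.closure_le _).2 ?_
      rintro _ (⟨i, rfl⟩ | rfl)
      · exact ⟨Finsupp.single (some i) 1, by simp⟩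
      · exact ⟨Finsupp.single none 1, by simp⟩
    exact this
  obtain ⟨c, hcC, hc⟩ := hlarge _ (countable_divisionHull F hF)
  let G : AddSubgroup B := F.map f ⊔ AddSubgroup.zmultiples (f c - d)
  -- The translation by `f c - d` sends `d` to `f c`. A relation `n d = f z + m (f c - d)` reads `(n
  -- + m) d = f (z + m c)`: if `n + m ≠ 0`, purity puts `d` in the range; otherwise `n c = z` lies
  -- in `F`, against the choice of `c`.
  obtain ⟨σ, hσ, hσd⟩ := exists_transvection G d (f c - d) (by
      intro n hn hmem
      obtain ⟨y, ⟨z, hz, rfl⟩, w, hw, h⟩ := AddSubgroup.mem_sup.1 hmem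
      obtain ⟨m, rfl⟩ := AddSubgroup.mem_zmultiples_iff.1 hw
      have h1 : ((n : ℤ) + m) • d = f (z + m • c) := by
        rw [map_add, map_zsmul, add_smul, natCast_zsmul, ← h, smul_sub]; abel
      by_cases hnm : (n : ℤ) + m = 0
      · rw [hnm, zero_smul, eq_comm, map_eq_zero_iff f hf] at h1
        have hm : m = -n := by omega
        refine hcC ⟨n, hn, ?_⟩
        rw [hm, neg_smul, natCast_zsmul, ← sub_eq_add_neg, sub_eq_zero] at h1
        exact h1 ▸ hz
      · refine hdr (hpure ((n : ℤ) + m).natAbs (by simpa using hnm) d ?_)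
        rcases Int.natAbs_eq ((n : ℤ) + m) with h2 | h2
        · rw [h2, natCast_zsmul] at h1
          exact ⟨_, h1.symm⟩
        · rw [h2, neg_smul, natCast_zsmul, neg_eq_iff_eq_neg, ← map_neg] at h1
          exact ⟨_, h1.symm⟩)
    (AddSubgroup.mem_sup_right (AddSubgroup.mem_zmultiples _)) (by
      intro n hn
      obtain ⟨y, hy⟩ := hc n hn
      obtain ⟨z, hz⟩ := hd n hn
      exact ⟨f y - z, by rw [smul_sub, hz, ← map_nsmul, hy]⟩)
  have hσF : ∀ a ∈ F, σ (f a) = f a := fun a ha =>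
    hσ _ (AddSubgroup.mem_sup_left ⟨a, ha, rfl⟩)
  refine ⟨α + c, ?_⟩
  rw [← StrongHomClass.realize_boundedFormula (plusEquiv σ)] at hb
  have hv : (plusEquiv σ) ∘ (Fin.snoc ((plusEmbedding f hf) ∘ x) (f α + d) : Fin (n + 1) → B) =
      Fin.snoc ((plusEmbedding f hf) ∘ x) ((plusEmbedding f hf) (α + c)) := by
    rw [Fin.comp_snoc]
    congr 1
    · funext i
      exact hσF _ (AddSubgroup.subset_closure (Or.inl ⟨i, rfl⟩))
    · change σ (f α + d) = f (α + c)
      rw [map_add, hσF _ (AddSubgroup.subset_closure (Or.inr rfl)), hσd, map_add]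
      abel
  rw [hv] at hb
  convert hb

end Core

/-! ### Passing to an ultrapower -/

section Ultrapower

open Filter

variable {A B : Type*} [AddCommGroup A] [AddCommGroup B]

/-- The ultrapower of a group, as a group of germs, is the ultrapower of structures. -/
def germEquivProduct (u : Ultrafilter ℕ) :
    Germ (u : Filter ℕ) A ≃[plusLang] (u : Filter ℕ).Product fun _ => A where
  toFun := id
  invFun := id
  left_inv := fun _ => rfl
  right_inv := fun _ => rfl
  map_fun' := fun {n} f v => by
    cases f
    have hw : ∀ i, ∃ w : ℕ → A, (w : Germ (u : Filter ℕ) A) = v i := fun i =>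
      Quotient.exists_rep (v i)
    choose w hw using hw
    obtain rfl : (fun i => (w i : Germ (u : Filter ℕ) A)) = v := funext hw
    exact (Ultraproduct.funMap_cast (L := plusLang) (M := fun _ => A) (u := u)
      (PlusFunc.plus : plusLang.Functions 2) w).symm
  map_rel' := fun {_} r => Empty.elim r

theorem realize_germ_const_iff (u : Ultrafilter ℕ) {n : ℕ} (φ : plusLang.Formula (Fin n))
    (x : Fin n → A) : φ.Realize (fun i => ((x i : A) : Germ (u : Filter ℕ) A)) ↔ φ.Realize x := by
  rw [← StrongHomClass.realize_formula (germEquivProduct u)]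
  refine (Ultraproduct.realize_formula_cast (M := fun _ => A) (u := u) φ fun i _ => x i).trans ?_
  simp

/-- The homomorphism of ultrapowers induced by a homomorphism. -/
def germMap (u : Ultrafilter ℕ) (f : A →+ B) : Germ (u : Filter ℕ) A →+ Germ (u : Filter ℕ) B where
  toFun := Germ.map f
  map_zero' := congrArg _ (funext fun _ => map_zero f)
  map_add' := fun x y => by
    induction x, y using Germ.inductionOn₂ with | _ x y => ?_
    exact congrArg _ (funext fun _ => map_add f _ _)

instance isAddTorsionFree_germ [IsAddTorsionFree B] (u : Filter ℕ) :
    IsAddTorsionFree (Germ u B) := by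
  refine ⟨fun n hn x y hxy => ?_⟩
  induction x, y using Germ.inductionOn₂ with | _ x y => ?_
  exact Germ.coe_eq.2 ((Germ.coe_eq.1 hxy).mono fun i hi => nsmul_right_injective hn hi)

/-- Almost every `i` is at least `n`, and then `n` divides `i!`. -/
theorem germ_factorial_divisible {u : Filter ℕ} (hu : ∀ m : ℕ, ∀ᶠ i in u, m ≤ i)
    (y : ℕ → B) (n : ℕ) (hn : n ≠ 0) :
    ∃ z : Germ u B, n • z = ((fun i => i.factorial • y i : ℕ → B) : Germ u B) := by
  refine ⟨((fun i => (i.factorial / n) • y i : ℕ → B) : Germ u B), ?_⟩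
  refine Germ.coe_eq.2 ((hu n).mono fun i hi => ?_)
  change n • (i.factorial / n) • y i = i.factorial • y i
  rw [smul_smul, Nat.mul_div_cancel' (Nat.dvd_factorial (Nat.pos_of_ne_zero hn) hi)]

/-- Diagonalization: the coordinate `i` is a multiple of `i!` chosen to differ from coordinate `i`
of each of the germs numbered `0, …, i` in an enumeration of `C`. -/
theorem exists_divisible_germ_notMem [IsAddTorsionFree A] [Nontrivial A] {u : Filter ℕ} [u.NeBot]
    (hu : ∀ m : ℕ, ∀ᶠ i in u, m ≤ i) (C : Set (Germ u A)) (hC : C.Countable) :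
    ∃ c ∉ C, ∀ n : ℕ, n ≠ 0 → ∃ y, n • y = c := by
  classical
  rcases C.eq_empty_or_nonempty with rfl | hne
  · exact ⟨0, by simp, fun n _ => ⟨0, smul_zero n⟩⟩
  obtain ⟨g, rfl⟩ := hC.exists_eq_range hne
  have hh : ∀ j, ∃ w : ℕ → A, (w : Germ u A) = g j := fun j => Quotient.exists_rep (g j)
  choose w hw using hh
  have : Infinite A := by
    obtain ⟨a, ha⟩ := exists_ne (0 : A)
    refine Infinite.of_injective (fun n : ℕ => n • a) fun m n hmn => ?_
    have h : ((m : ℤ) - n) • a = 0 := by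
      rw [sub_smul, natCast_zsmul, natCast_zsmul]; exact sub_eq_zero.2 hmn
    have := (smul_eq_zero.1 h).resolve_right ha
    omega
  have hy : ∀ i : ℕ, ∃ y : A, ∀ j ≤ i, i.factorial • y ≠ w j i := by
    intro i
    have hinf : (Set.range fun y : A => i.factorial • y).Infinite :=
      Set.infinite_range_of_injective (nsmul_right_injective i.factorial_ne_zero)
    obtain ⟨_, ⟨y, rfl⟩, hy⟩ := hinf.exists_notMem_finset
      ((Finset.range (i + 1)).image fun j => w j i)
    refine ⟨y, fun j hj h => hy (Finset.mem_image.2 ⟨j, by simpa [Nat.lt_succ_iff] using hj, h.symm⟩)⟩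
  choose y hy using hy
  refine ⟨_, ?_, germ_factorial_divisible hu y⟩
  rintro ⟨j, hj⟩
  rw [← hw] at hj
  obtain ⟨i, hi, hji⟩ := ((Germ.coe_eq.1 hj).and (hu j)).exists
  exact hy i j hji hi.symm

/-- A monomorphism of torsion-free groups with torsion-free divisible cokernel is elementary. -/
theorem realize_comp_iff_of_pure_of_dense [IsAddTorsionFree B] [Nontrivial A] (f : A →+ B)
    (hf : Function.Injective f)
    (hpure : ∀ n : ℕ, n ≠ 0 → ∀ b, n • b ∈ f.range → b ∈ f.range)
    (hdense : ∀ n : ℕ, n ≠ 0 → ∀ b, ∃ a d, b = f a + n • d)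
    {n : ℕ} (φ : plusLang.Formula (Fin n)) (x : Fin n → A) :
    φ.Realize (f ∘ x) ↔ φ.Realize x := by
  have : IsAddTorsionFree A := hf.isAddTorsionFree f
  let u : Ultrafilter ℕ := hyperfilter ℕ
  have hu : ∀ m : ℕ, ∀ᶠ i in (u : Filter ℕ), m ≤ i := fun m =>
    Nat.hyperfilter_le_atTop (eventually_ge_atTop m)
  have key := realize_comp_iff_of_exists_divisible (germMap u f) (by
      intro x y hxy
      induction x, y using Germ.inductionOn₂ with | _ x y => ?_
      exact Germ.coe_eq.2 ((Germ.coe_eq.1 hxy).mono fun i hi => hf hi))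
    (by
      rintro n hn b ⟨a, ha⟩
      induction a, b using Germ.inductionOn₂ with | _ a b => ?_
      have h : ∀ᶠ i in (u : Filter ℕ), f (a i) = n • b i := Germ.coe_eq.1 ha
      have h2 : ∀ i, ∃ c, f (a i) = n • b i → f c = b i := by
        intro i
        by_cases hi : f (a i) = n • b i
        · obtain ⟨c, hc⟩ := hpure n hn (b i) ⟨_, hi⟩
          exact ⟨c, fun _ => hc⟩
        · exact ⟨0, fun h => absurd h hi⟩
      choose c hc using h2
      exact ⟨(c : Germ _ A), Germ.coe_eq.2 (h.mono hc)⟩)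
    (by
      intro b
      induction b using Germ.inductionOn with | _ b => ?_
      -- Density modulo `i!` in coordinate `i` makes the remainder germ divisible by every nonzero
      -- integer.
      choose a d had using fun i : ℕ => hdense _ i.factorial_ne_zero (b i)
      exact ⟨(a : Germ _ A), _, congrArg _ (funext had), germ_factorial_divisible hu d⟩)
    (by
      intro C hC
      exact exists_divisible_germ_notMem hu C hC) φ (fun i => ((x i : A) : Germ (u : Filter ℕ) A))
  rw [realize_germ_const_iff u] at key
  rw [← key, ← realize_germ_const_iff u]
  rfl

end Ultrapower

/-- A monomorphism of torsion-free groups with torsion-free divisible cokernel, as an elementary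
embedding. -/
def elementaryEmbeddingOfPureDense {A B : Type*} [AddCommGroup A] [AddCommGroup B]
    [IsAddTorsionFree B] [Nontrivial A] (f : A →+ B) (hf : Function.Injective f)
    (hpure : ∀ n : ℕ, n ≠ 0 → ∀ b, n • b ∈ f.range → b ∈ f.range)
    (hdense : ∀ n : ℕ, n ≠ 0 → ∀ b, ∃ a d, b = f a + n • d) : A ↪ₑ[plusLang] B where
  toFun := f
  map_formula' := fun {_} φ x => realize_comp_iff_of_pure_of_dense f hf hpure hdense φ x

end SBGroups

namespace SBGroups

/-! ### Pure subrings of `ℤ_p`, their tuples, and the two hulls -/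

section PadicSubrings

variable {p : ℕ} [hp : Fact p.Prime]

theorem padicInt_eq_zero_of_forall_pow_dvd {x : ℤ_[p]} (h : ∀ m : ℕ, (p : ℤ_[p]) ^ m ∣ x) :
    x = 0 := by
  by_contra hx
  have h1 := (PadicInt.mem_span_pow_iff_le_valuation x hx (x.valuation + 1)).1
    (Ideal.mem_span_singleton.2 (h _))
  omega

theorem exists_natCast_add_pow_mul (m : ℕ) (x : ℤ_[p]) :
    ∃ (z : ℕ) (w : ℤ_[p]), x = z + (p : ℤ_[p]) ^ m * w := by
  obtain ⟨w, hw⟩ := Ideal.mem_span_singleton.1 (PadicInt.appr_spec m x)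
  exact ⟨x.appr m, w, by rw [← hw]; ring⟩

/-- Up to a unit, `n` is a power of `p`, so this reduces to approximation modulo that power. -/
theorem exists_natCast_add_mul {n : ℕ} (hn : n ≠ 0) (x : ℤ_[p]) :
    ∃ (z : ℕ) (w : ℤ_[p]), x = z + n * w := by
  have hn' : (n : ℤ_[p]) ≠ 0 := Nat.cast_ne_zero.2 hn
  obtain ⟨z, w, h⟩ := exists_natCast_add_pow_mul (n : ℤ_[p]).valuation x
  refine ⟨z, ↑(PadicInt.unitCoeff hn')⁻¹ * w, ?_⟩
  have h2 : (n : ℤ_[p]) * (↑(PadicInt.unitCoeff hn')⁻¹ * w) = (p : ℤ_[p]) ^ (n : ℤ_[p]).valuation * w := by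
    refine (congrArg (· * _) (PadicInt.unitCoeff_spec hn')).trans ?_
    rw [mul_assoc, mul_left_comm, Units.mul_inv_cancel_left]
  rw [h2, h]

/-- Every subgroup of `ℤ_p ^ k` is reduced. -/
theorem isReducedGroup_of_padic {k : ℕ} (H : AddSubgroup (Fin k → ℤ_[p])) : IsReducedGroup H := by
  intro D hD
  rw [eq_bot_iff]
  intro d hd
  refine AddSubgroup.mem_bot.2 (Subtype.ext (funext fun s => ?_))
  refine padicInt_eq_zero_of_forall_pow_dvd fun m => ?_
  obtain ⟨y, -, rfl⟩ := hD (p ^ m) (pow_ne_zero _ hp.out.ne_zero) d hd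
  exact ⟨(y : Fin k → ℤ_[p]) s, by simp⟩

/-- A subring of `ℤ_p` whose additive group is pure. -/
def IsPureSubring (P : Subring ℤ_[p]) : Prop :=
  ∀ n : ℕ, n ≠ 0 → ∀ x : ℤ_[p], (n : ℤ_[p]) * x ∈ P → x ∈ P

/-- The group of `k`-tuples from a subring of `ℤ_p`. -/
noncomputable def tuples (k : ℕ) (P : Subring ℤ_[p]) : AddSubgroup (Fin k → ℤ_[p]) :=
  AddSubgroup.pi Set.univ fun _ => P.toAddSubgroup

theorem mem_tuples {k : ℕ} {P : Subring ℤ_[p]} {v : Fin k → ℤ_[p]} :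
    v ∈ tuples k P ↔ ∀ s, v s ∈ P := by
  simp [tuples, AddSubgroup.mem_pi]

theorem nontrivial_tuples {k : ℕ} (hk : 1 ≤ k) (P : Subring ℤ_[p]) : Nontrivial (tuples k P) :=
  ⟨⟨⟨fun _ => 1, mem_tuples.2 fun _ => P.one_mem⟩, 0, fun h =>
    one_ne_zero (congrFun (congrArg Subtype.val h) (⟨0, hk⟩ : Fin k))⟩⟩

/-- Multiplication by `u`, as a homomorphism of groups of tuples. -/
noncomputable def mulTuples (k : ℕ) {P Q : Subring ℤ_[p]} (u : ℤ_[p]) (hu : ∀ x ∈ P, u * x ∈ Q) :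
    tuples k P →+ tuples k Q where
  toFun v := ⟨fun s => u * v.1 s, mem_tuples.2 fun s => hu _ (mem_tuples.1 v.2 s)⟩
  map_zero' := Subtype.ext (funext fun _ => mul_zero u)
  map_add' _ _ := Subtype.ext (funext fun _ => mul_add u _ _)

/-- Multiplication by a unit of `ℤ_p` is an elementary embedding. -/
theorem nonempty_elementaryEmbedding_tuples {k : ℕ} (hk : 1 ≤ k) {P Q : Subring ℤ_[p]}
    (hP : IsPureSubring P) (hQ : IsPureSubring Q) (u : ℤ_[p]ˣ)
    (hu : ∀ x ∈ P, (u : ℤ_[p]) * x ∈ Q) : Nonempty (tuples k P ↪ₑ[plusLang] tuples k Q) := by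
  have := nontrivial_tuples hk P
  refine ⟨elementaryEmbeddingOfPureDense (mulTuples k u hu) ?_ ?_ ?_⟩
  · intro v w h
    refine Subtype.ext (funext fun s => ?_)
    exact u.isUnit.mul_left_cancel (congrFun (congrArg Subtype.val h) s)
  · rintro n hn b ⟨a, ha⟩
    have h : ∀ s, (u : ℤ_[p]) * a.1 s = n * b.1 s := fun s => by
      rw [← nsmul_eq_mul]
      exact congrFun (congrArg Subtype.val ha) s
    -- Although `u⁻¹` need not lie in `P`, from `u a = n b` follows `n (u⁻¹ b) = a ∈ P`, and purity
    -- gives `u⁻¹ b ∈ P`.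
    refine ⟨⟨fun s => ((u⁻¹ : ℤ_[p]ˣ) : ℤ_[p]) * b.1 s, mem_tuples.2 fun s => hP n hn _ ?_⟩, ?_⟩
    · rw [mul_left_comm, ← h, Units.inv_mul_cancel_left]
      exact mem_tuples.1 a.2 s
    · exact Subtype.ext (funext fun s => Units.mul_inv_cancel_left u _)
  · intro n hn b
    -- Approximating `u⁻¹ b` by integers modulo `n` makes the preimage an integer tuple, hence in
    -- every subring; purity of `Q` then handles the remainder.
    choose z w hzw using fun s => exists_natCast_add_mul hn (((u⁻¹ : ℤ_[p]ˣ) : ℤ_[p]) * b.1 s)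
    have h : ∀ s, b.1 s = (u : ℤ_[p]) * (z s : ℤ_[p]) + n * ((u : ℤ_[p]) * w s) := fun s => by
      rw [mul_left_comm, ← mul_add, ← hzw, Units.mul_inv_cancel_left]
    have hz : ∀ s, (z s : ℤ_[p]) ∈ P := fun s => natCast_mem P _
    refine ⟨⟨fun s => z s, mem_tuples.2 hz⟩, ⟨fun s => (u : ℤ_[p]) * w s, mem_tuples.2 fun s => ?_⟩, ?_⟩
    · refine hQ n hn _ ?_
      rw [← sub_eq_of_eq_add' (h s)]
      exact Q.sub_mem (mem_tuples.1 b.2 s) (hu _ (hz s))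
    · refine Subtype.ext (funext fun s => ?_)
      change b.1 s = (u : ℤ_[p]) * (z s : ℤ_[p]) + n • ((u : ℤ_[p]) * w s)
      rw [nsmul_eq_mul, h]

/-- The smallest pure subring of `ℤ_p` containing a given subring. -/
noncomputable def isolator (R : Subring ℤ_[p]) : Subring ℤ_[p] where
  carrier := {x | ∃ n : ℕ, n ≠ 0 ∧ (n : ℤ_[p]) * x ∈ R}
  one_mem' := ⟨1, one_ne_zero, by simp⟩
  zero_mem' := ⟨1, one_ne_zero, by simp⟩
  mul_mem' := by
    rintro x y ⟨m, hm, hx⟩ ⟨n, hn, hy⟩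
    refine ⟨m * n, mul_ne_zero hm hn, ?_⟩
    rw [Nat.cast_mul, mul_mul_mul_comm]
    exact R.mul_mem hx hy
  add_mem' := by
    rintro x y ⟨m, hm, hx⟩ ⟨n, hn, hy⟩
    refine ⟨m * n, mul_ne_zero hm hn, ?_⟩
    have : ((m * n : ℕ) : ℤ_[p]) * (x + y) = n * (m * x) + m * (n * y) := by push_cast; ring
    rw [this]
    exact R.add_mem (R.mul_mem (natCast_mem R n) hx) (R.mul_mem (natCast_mem R m) hy)
  neg_mem' := by
    rintro x ⟨m, hm, hx⟩
    exact ⟨m, hm, by rw [mul_neg]; exact R.neg_mem hx⟩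

theorem le_isolator (R : Subring ℤ_[p]) : R ≤ isolator R := fun x hx =>
  ⟨1, one_ne_zero, by simpa using hx⟩

theorem isPureSubring_isolator (R : Subring ℤ_[p]) : IsPureSubring (isolator R) := by
  rintro n hn x ⟨m, hm, h⟩
  exact ⟨m * n, mul_ne_zero hm hn, by rwa [Nat.cast_mul, mul_assoc]⟩

theorem isPureSubgroup_tuples (k : ℕ) {P : Subring ℤ_[p]} (hP : IsPureSubring P) :
    IsPureSubgroup (tuples k P) := by
  rintro n h hh ⟨x, rfl⟩
  rcases eq_or_ne n 0 with rfl | hn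
  · exact ⟨0, zero_mem _, by simp⟩
  · refine ⟨x, mem_tuples.2 fun s => hP n hn _ ?_, rfl⟩
    simpa using mem_tuples.1 hh s

/-- The additive span of a multiplicative monoid is already a ring, so a subgroup containing the
generators contains every `r e_s` with `r` in that ring. Purity and unique division then give the
isolator. -/
theorem pureHull_single_eq_tuples (k : ℕ) (M : Submonoid ℤ_[p]) :
    pureHull (AddSubgroup.closure {x : Fin k → ℤ_[p] | ∃ m ∈ M, ∃ s, x = Pi.single s m} :
      Set (Fin k → ℤ_[p])) = tuples k (isolator (Subring.closure (M : Set ℤ_[p]))) := by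
  set R := Subring.closure (M : Set ℤ_[p])
  apply le_antisymm
  · refine sInf_le ⟨isPureSubgroup_tuples k (isPureSubring_isolator R), ?_⟩
    refine (AddSubgroup.closure_le _).2 ?_
    rintro _ ⟨m, hm, s, rfl⟩
    refine mem_tuples.2 fun t => ?_
    rcases eq_or_ne t s with rfl | h
    · rw [Pi.single_eq_same]
      exact le_isolator R (Subring.subset_closure hm)
    · rw [Pi.single_eq_of_ne h]
      exact zero_mem _
  · refine le_sInf ?_
    rintro H ⟨hH, hMH⟩
    have hR : ∀ r ∈ R, ∀ s, Pi.single s r ∈ H := by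
      intro r hr s
      rw [Subring.mem_closure_iff, Submonoid.closure_eq] at hr
      have : AddSubgroup.closure (M : Set ℤ_[p]) ≤
          H.comap (AddMonoidHom.single (fun _ : Fin k => ℤ_[p]) s) :=
        (AddSubgroup.closure_le _).2 fun m hm =>
          hMH (AddSubgroup.subset_closure ⟨m, hm, s, rfl⟩)
      exact this hr
    intro v hv
    rw [← Finset.univ_sum_single v]
    refine H.sum_mem fun s _ => ?_
    obtain ⟨n, hn, h⟩ := mem_tuples.1 hv s
    have e : n • Pi.single s (v s) = (Pi.single s ((n : ℤ_[p]) * v s) : Fin k → ℤ_[p]) := by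
      rw [← Pi.single_smul, nsmul_eq_mul]
    obtain ⟨x, hx, hxe⟩ := hH n _ (hR _ h s) ⟨_, e⟩
    rw [← nsmul_right_injective hn (hxe.trans e.symm)]
    exact hx

/-- The monomials `γ₁ ^ i * γ₂ ^ j`. -/
noncomputable def monomialsOne (γ₁ γ₂ : ℤ_[p]) : Submonoid ℤ_[p] where
  carrier := {x | ∃ i j : ℕ, x = γ₁ ^ i * γ₂ ^ j}
  one_mem' := ⟨0, 0, by simp⟩
  mul_mem' := by
    rintro _ _ ⟨i, j, rfl⟩ ⟨i', j', rfl⟩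
    exact ⟨i + i', j + j', by ring⟩

/-- The monomials `γ₁ ^ i * γ₂ ^ j` with `1 ≤ i`, and `1`. -/
noncomputable def monomialsTwo (γ₁ γ₂ : ℤ_[p]) : Submonoid ℤ_[p] where
  carrier := {x | (∃ i j : ℕ, 1 ≤ i ∧ x = γ₁ ^ i * γ₂ ^ j) ∨ x = 1}
  one_mem' := Or.inr rfl
  mul_mem' := by
    rintro _ _ (⟨i, j, hi, rfl⟩ | rfl) (⟨i', j', hi', rfl⟩ | rfl)
    · exact Or.inl ⟨i + i', j + j', by omega, by ring⟩
    · exact Or.inl ⟨i, j, hi, by ring⟩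
    · exact Or.inl ⟨i', j', hi', by ring⟩
    · exact Or.inr (by ring)

/-- The ring of `p`-adic integers in `ℚ[γ₁, γ₂]`. -/
noncomputable def ringOne (γ₁ γ₂ : ℤ_[p]) : Subring ℤ_[p] :=
  isolator (Subring.closure (monomialsOne γ₁ γ₂ : Set ℤ_[p]))

/-- The ring of `p`-adic integers in `ℚ + γ₁ ℚ[γ₁, γ₂]`. -/
noncomputable def ringTwo (γ₁ γ₂ : ℤ_[p]) : Subring ℤ_[p] :=
  isolator (Subring.closure (monomialsTwo γ₁ γ₂ : Set ℤ_[p]))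

theorem hullOne_eq_tuples (k : ℕ) (γ₁ γ₂ : ℤ_[p]) : hullOne k γ₁ γ₂ = tuples k (ringOne γ₁ γ₂) := by
  rw [hullOne, ringOne, ← pureHull_single_eq_tuples]
  congr 3
  ext x
  constructor
  · rintro ⟨i, j, s, rfl⟩
    exact ⟨_, ⟨i, j, rfl⟩, s, rfl⟩
  · rintro ⟨_, ⟨i, j, rfl⟩, s, rfl⟩
    exact ⟨i, j, s, rfl⟩

theorem hullTwo_eq_tuples (k : ℕ) (γ₁ γ₂ : ℤ_[p]) : hullTwo k γ₁ γ₂ = tuples k (ringTwo γ₁ γ₂) := by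
  rw [hullTwo, ringTwo, ← pureHull_single_eq_tuples]
  congr 3
  ext x
  constructor
  · rintro (⟨i, j, s, hi, rfl⟩ | ⟨s, rfl⟩)
    · exact ⟨_, Or.inl ⟨i, j, hi, rfl⟩, s, rfl⟩
    · exact ⟨_, Or.inr rfl, s, rfl⟩
  · rintro ⟨_, ⟨i, j, hi, rfl⟩ | rfl, s, rfl⟩
    · exact Or.inl ⟨i, j, s, hi, rfl⟩
    · exact Or.inr ⟨s, rfl⟩

theorem ringTwo_le_ringOne (γ₁ γ₂ : ℤ_[p]) : ringTwo γ₁ γ₂ ≤ ringOne γ₁ γ₂ := by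
  rintro x ⟨n, hn, h⟩
  refine ⟨n, hn, Subring.closure_mono ?_ h⟩
  rintro _ (⟨i, j, -, rfl⟩ | rfl)
  · exact ⟨i, j, rfl⟩
  · exact one_mem _

/-- A factor `γ₁` raises the exponent of `γ₁` to at least `1`. -/
theorem mul_mem_ringTwo {γ₁ γ₂ x : ℤ_[p]} (hx : x ∈ ringOne γ₁ γ₂) : γ₁ * x ∈ ringTwo γ₁ γ₂ := by
  obtain ⟨n, hn, h⟩ := hx
  refine ⟨n, hn, ?_⟩
  rw [mul_left_comm]
  rw [Subring.mem_closure_iff, Submonoid.closure_eq] at h ⊢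
  have : AddSubgroup.closure (monomialsOne γ₁ γ₂ : Set ℤ_[p]) ≤
      (AddSubgroup.closure (monomialsTwo γ₁ γ₂ : Set ℤ_[p])).comap (AddMonoidHom.mulLeft γ₁) := by
    refine (AddSubgroup.closure_le _).2 ?_
    rintro _ ⟨i, j, rfl⟩
    exact AddSubgroup.subset_closure
      (Or.inl ⟨i + 1, j, by omega, by simp only [AddMonoidHom.coe_mulLeft]; ring⟩)
  exact this h

end PadicSubrings

/-! ### `ℤ_(p)` inside `ℤ_p`, and models of the theory -/

section LocalizedIntegers

variable {p : ℕ} [hp : Fact p.Prime]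

theorem isUnit_intCast_of_notMem {c : ℤ} (hc : c ∉ Ideal.span {(p : ℤ)}) :
    IsUnit (c : ℤ_[p]) := by
  rw [PadicInt.isUnit_iff]
  refine le_antisymm (PadicInt.norm_le_one _) (not_lt.1 fun h => hc ?_)
  exact Ideal.mem_span_singleton.2 ((PadicInt.norm_int_lt_one_iff_dvd c).1 h)

/-- The embedding of `ℤ_(p)` in `ℤ_p`. -/
noncomputable def zlocHom (p : ℕ) [Fact p.Prime] : ZLoc p →+* ℤ_[p] :=
  IsLocalization.lift (M := (Ideal.span {(p : ℤ)}).primeCompl) (g := Int.castRingHom ℤ_[p])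
    fun c => isUnit_intCast_of_notMem c.2

theorem zlocHom_mk'_eq_iff {a : ℤ} {c : (Ideal.span {(p : ℤ)}).primeCompl} {x : ℤ_[p]} :
    zlocHom p (IsLocalization.mk' (ZLoc p) a c) = x ↔ (a : ℤ_[p]) = ((c : ℤ) : ℤ_[p]) * x :=
  IsLocalization.lift_mk'_spec _ _ _ _

theorem zlocHom_injective : Function.Injective (zlocHom p) := by
  refine (IsLocalization.lift_injective_iff _).2 fun x y => ?_
  have h : Function.Injective (algebraMap ℤ (ZLoc p)) :=
    IsLocalization.injective _ (Ideal.primeCompl_le_nonZeroDivisors (Ideal.span {(p : ℤ)}))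
  rw [h.eq_iff]
  exact Int.cast_inj.symm

theorem isPureSubring_range_zlocHom : IsPureSubring (zlocHom p).range := by
  rintro n hn x ⟨y, hy⟩
  obtain ⟨a, c, rfl⟩ := IsLocalization.exists_mk'_eq (Ideal.span {(p : ℤ)}).primeCompl y
  rw [zlocHom_mk'_eq_iff] at hy
  -- To divide `a / c` by `n = p ^ v * m`, the factor `m`, prime to `p`, goes into the denominator,
  -- while `p ^ v` divides `a` in `ℤ_p` and hence in `ℤ`.
  obtain ⟨v, m, hm, rfl⟩ := Nat.exists_eq_pow_mul_and_not_dvd hn p hp.out.ne_one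
  have hm' : (m : ℤ) ∈ (Ideal.span {(p : ℤ)}).primeCompl := fun h =>
    hm (Int.natCast_dvd_natCast.1 (Ideal.mem_span_singleton.1 h))
  obtain ⟨a', rfl⟩ := (PadicInt.pow_p_dvd_int_iff v a).1 (by
    rw [hy]; exact ⟨(c : ℤ) * (m * x), by push_cast; ring⟩)
  refine ⟨IsLocalization.mk' (ZLoc p) a' (c * ⟨m, hm'⟩), zlocHom_mk'_eq_iff.2 ?_⟩
  have hp0 : (p : ℤ_[p]) ^ v ≠ 0 := pow_ne_zero _ (Nat.cast_ne_zero.2 hp.out.ne_zero)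
  refine mul_left_cancel₀ hp0 ?_
  push_cast at hy ⊢
  rw [hy]; ring

theorem range_zlocHom_le {P : Subring ℤ_[p]} (hP : IsPureSubring P) : (zlocHom p).range ≤ P := by
  rintro _ ⟨y, rfl⟩
  obtain ⟨a, c, rfl⟩ := IsLocalization.exists_mk'_eq (Ideal.span {(p : ℤ)}).primeCompl y
  have h := zlocHom_mk'_eq_iff.1 (Eq.refl (zlocHom p (IsLocalization.mk' (ZLoc p) a c)))
  have hc : (c : ℤ) ≠ 0 := fun h0 => c.2 (by rw [h0]; exact Ideal.zero_mem _)
  refine hP (c : ℤ).natAbs (by simpa using hc) _ ?_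
  have hP' : ((c : ℤ) : ℤ_[p]) * zlocHom p (IsLocalization.mk' (ZLoc p) a c) ∈ P :=
    h ▸ intCast_mem P a
  rcases Int.natAbs_eq (c : ℤ) with h2 | h2
  · rw [h2] at hP'
    simpa only [Int.cast_natCast] using hP'
  · rw [h2] at hP'
    have := P.neg_mem hP'
    simpa only [Int.cast_neg, Int.cast_natCast, neg_mul, neg_neg] using this

/-- `ℤ_(p)^k` is isomorphic to a group of tuples. -/
noncomputable def zlocEquiv (p : ℕ) [Fact p.Prime] (k : ℕ) :
    (Fin k → ZLoc p) ≃+ tuples k (zlocHom p).range where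
  toFun v := ⟨fun s => zlocHom p (v s), mem_tuples.2 fun s => ⟨v s, rfl⟩⟩
  invFun w s := (mem_tuples.1 w.2 s).choose
  left_inv v := funext fun s => zlocHom_injective
    (Exists.choose_spec (p := fun x => zlocHom p x = zlocHom p (v s)) ⟨v s, rfl⟩)
  right_inv w := Subtype.ext (funext fun s => (mem_tuples.1 w.2 s).choose_spec)
  map_add' _ _ := Subtype.ext (funext fun _ => map_add (zlocHom p) _ _)

theorem tuples_models_thZLoc {k : ℕ} (hk : 1 ≤ k) {P : Subring ℤ_[p]} (hP : IsPureSubring P) :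
    tuples k P ⊨ thZLoc p k := by
  obtain ⟨g⟩ := nonempty_elementaryEmbedding_tuples hk isPureSubring_range_zlocHom hP 1
    fun x hx => by simpa using range_zlocHom_le hP hx
  have h : (Fin k → ZLoc p) ≅[plusLang] tuples k P :=
    (plusEquiv (zlocEquiv p k)).toElementaryEmbedding.elementarilyEquivalent.trans
      g.elementarilyEquivalent
  exact h.theory_model_iff.1 (model_completeTheory (M := Fin k → ZLoc p))

end LocalizedIntegers

end SBGroups

namespace SBGroups

/-! ### The centre of the ring generated by pure embeddings -/

section Center

variable {p : ℕ} [hp : Fact p.Prime] {k : ℕ} {P : Subring ℤ_[p]}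

/-- Scalar multiplication on a group of tuples, as a ring homomorphism. -/
noncomputable def scalarEnd (k : ℕ) (P : Subring ℤ_[p]) : P →+* AddMonoid.End (tuples k P) where
  toFun c := mulTuples k (c : ℤ_[p]) fun _ hx => P.mul_mem c.2 hx
  map_one' := AddMonoidHom.ext fun _ => Subtype.ext (funext fun _ => one_mul _)
  map_mul' _ _ := AddMonoidHom.ext fun _ => Subtype.ext (funext fun _ => mul_assoc _ _ _)
  map_zero' := AddMonoidHom.ext fun _ => Subtype.ext (funext fun _ => zero_mul _)
  map_add' _ _ := AddMonoidHom.ext fun _ => Subtype.ext (funext fun _ => add_mul _ _ _)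

theorem scalarEnd_apply (c : P) (v : tuples k P) (s : Fin k) :
    (scalarEnd k P c v).1 s = c * v.1 s := rfl

/-- The tuple with a single nonzero entry. -/
noncomputable def singleTuple (s : Fin k) (x : P) : tuples k P :=
  ⟨Pi.single s x, mem_tuples.2 fun t => by
    rcases eq_or_ne t s with rfl | h
    · rw [Pi.single_eq_same]; exact x.2
    · rw [Pi.single_eq_of_ne h]; exact P.zero_mem⟩

/-- The matrix unit with entry at `(i, j)`, as an endomorphism of a group of tuples. -/
noncomputable def matrixUnitEnd (P : Subring ℤ_[p]) (i j : Fin k) : AddMonoid.End (tuples k P) :=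
  { toFun := fun v => singleTuple i ⟨v.1 j, mem_tuples.1 v.2 j⟩
    map_zero' := Subtype.ext (Pi.single_zero i)
    map_add' := fun _ _ => Subtype.ext (Pi.single_add i _ _) }

theorem matrixUnitEnd_apply (i j : Fin k) (v : tuples k P) :
    (matrixUnitEnd P i j v).1 = Pi.single i (v.1 j) := rfl

/-- Modulo `p ^ m` the scalar `c` is an integer, with which additive maps commute; purity keeps the
quotient `w` in `P`. So the commutator is divisible by every `p ^ m`. -/
theorem scalarEnd_comm (hP : IsPureSubring P) (c : P) (f : AddMonoid.End (tuples k P)) :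
    scalarEnd k P c * f = f * scalarEnd k P c := by
  refine AddMonoidHom.ext fun v => Subtype.ext (funext fun s => ?_)
  rw [← sub_eq_zero]
  refine padicInt_eq_zero_of_forall_pow_dvd fun m => ?_
  obtain ⟨z, w, h⟩ := exists_natCast_add_pow_mul m (c : ℤ_[p])
  have hw : w ∈ P := by
    refine hP (p ^ m) (pow_ne_zero _ hp.out.ne_zero) _ ?_
    rw [Nat.cast_pow, ← sub_eq_of_eq_add' h]
    exact P.sub_mem c.2 (natCast_mem P z)
  have h1 : f (scalarEnd k P c v) = z • f v + p ^ m • f (scalarEnd k P ⟨w, hw⟩ v) := by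
    rw [← map_nsmul, ← map_nsmul, ← map_add]
    congr 1
    refine Subtype.ext (funext fun s => ?_)
    change (c : ℤ_[p]) * v.1 s = z • v.1 s + p ^ m • (w * v.1 s)
    rw [h, nsmul_eq_mul, nsmul_eq_mul, Nat.cast_pow]
    ring
  have h2 : (f (scalarEnd k P c v)).1 s =
      z * (f v).1 s + p ^ m * (f (scalarEnd k P ⟨w, hw⟩ v)).1 s := by
    rw [h1]
    simp
  refine ⟨w * (f v).1 s - (f (scalarEnd k P ⟨w, hw⟩ v)).1 s, ?_⟩
  change (c : ℤ_[p]) * (f v).1 s - (f (scalarEnd k P c v)).1 s = _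
  rw [h2, h]; ring

theorem mem_pureEndRing_of_bijective {G : Type*} [AddCommGroup G] (f : AddMonoid.End G)
    (hf : Function.Bijective f) : f ∈ pureEndRing G := by
  refine Subring.subset_closure ⟨hf.1, ?_⟩
  intro n h _ ⟨x, hx⟩
  exact ⟨x, hf.2 x, hx⟩

/-- Off the diagonal the matrix unit squares to zero, so adding `1` gives an automorphism; subtract
`1` again. -/
theorem matrixUnitEnd_mem_pureEndRing {i j : Fin k} (hij : i ≠ j) :
    matrixUnitEnd P i j ∈ pureEndRing (tuples k P) := by
  have hsq : matrixUnitEnd P i j * matrixUnitEnd P i j = 0 := by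
    refine AddMonoidHom.ext fun v => Subtype.ext ?_
    change (matrixUnitEnd P i j (matrixUnitEnd P i j v)).1 = 0
    rw [matrixUnitEnd_apply, matrixUnitEnd_apply, Pi.single_eq_of_ne hij.symm, Pi.single_zero]
  have h1 : (1 - matrixUnitEnd P i j) * (1 + matrixUnitEnd P i j) = 1 := by
    rw [sub_mul, mul_add, mul_add, hsq]; simp
  have h2 : (1 + matrixUnitEnd P i j) * (1 - matrixUnitEnd P i j) = 1 := by
    rw [add_mul, mul_sub, mul_sub, hsq]; simp
  have h := mem_pureEndRing_of_bijective (1 + matrixUnitEnd P i j)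
    (Function.bijective_iff_has_inverse.2 ⟨(1 - matrixUnitEnd P i j : AddMonoid.End _),
      fun v => DFunLike.congr_fun h1 v, fun v => DFunLike.congr_fun h2 v⟩)
  simpa using Subring.sub_mem _ h (Subring.one_mem _)

/-- A scalar that is a unit of `ℤ_p` is injective with pure image, even if not invertible in `P`.
Otherwise `1 - c` is a unit, as `ℤ_p` is local. -/
theorem scalarEnd_mem_pureEndRing (hP : IsPureSubring P) (c : P) :
    scalarEnd k P c ∈ pureEndRing (tuples k P) := by
  have key : ∀ c : P, IsUnit (c : ℤ_[p]) → scalarEnd k P c ∈ pureEndRing (tuples k P) := by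
    intro c hc
    refine Subring.subset_closure ⟨fun v w h => Subtype.ext (funext fun s => ?_), ?_⟩
    · exact hc.mul_left_cancel (congrFun (congrArg Subtype.val h) s)
    · rintro n _ ⟨v, rfl⟩ ⟨x, hx⟩
      rcases eq_or_ne n 0 with rfl | hn
      · exact ⟨0, zero_mem _, by rw [← hx, zero_smul, zero_smul]⟩
      obtain ⟨u, hu⟩ := hc
      refine ⟨x, ⟨⟨fun s => ((u⁻¹ : ℤ_[p]ˣ) : ℤ_[p]) * x.1 s,
        mem_tuples.2 fun s => hP n hn _ ?_⟩, ?_⟩, hx⟩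
      · have h : (n : ℤ_[p]) * x.1 s = u * v.1 s := by
          rw [hu, ← nsmul_eq_mul]
          exact congrFun (congrArg Subtype.val hx) s
        rw [mul_left_comm, h, Units.inv_mul_cancel_left]
        exact mem_tuples.1 v.2 s
      · refine Subtype.ext (funext fun s => ?_)
        change (c : ℤ_[p]) * (((u⁻¹ : ℤ_[p]ˣ) : ℤ_[p]) * x.1 s) = x.1 s
        rw [← hu, Units.mul_inv_cancel_left]
  by_cases hc : IsUnit (c : ℤ_[p])
  · exact key c hc
  · have h1 : IsUnit ((1 - c : P) : ℤ_[p]) := by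
      push_cast
      exact (IsLocalRing.isUnit_or_isUnit_one_sub_self (c : ℤ_[p])).resolve_left hc
    have h2 := Subring.sub_mem _ (Subring.one_mem _) (key (1 - c) h1)
    rwa [← map_one (scalarEnd k P), ← map_sub, sub_sub_cancel] at h2

/-- Commuting with the off-diagonal matrix units forces `f` to act on all basis vectors by one
scalar `c`. Additive maps are automatically `P`-linear by `scalarEnd_comm`, so this determines `f`.
-/
theorem exists_eq_scalarEnd (hk : 1 ≤ k) (hP : IsPureSubring P)
    (f : AddMonoid.End (tuples k P)) (hf : ∀ g ∈ pureEndRing (tuples k P), g * f = f * g) :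
    ∃ c, scalarEnd k P c = f := by
  have hfE : ∀ i j, i ≠ j → (f (singleTuple i 1)).1 =
      Pi.single i ((f (singleTuple j 1)).1 j) := by
    intro i j hij
    have h := DFunLike.congr_fun (hf _ (matrixUnitEnd_mem_pureEndRing hij)) (singleTuple j 1)
    have h2 : matrixUnitEnd P i j (singleTuple j 1) = singleTuple i 1 := by
      refine Subtype.ext ?_
      rw [matrixUnitEnd_apply]
      simp [singleTuple]
    change matrixUnitEnd P i j (f (singleTuple j 1)) = f (matrixUnitEnd P i j _) at h
    rw [h2] at h
    rw [← h, matrixUnitEnd_apply]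
  let o : Fin k := ⟨0, hk⟩
  let c : P := ⟨(f (singleTuple o 1)).1 o, mem_tuples.1 (f (singleTuple o 1)).2 o⟩
  have hfe : ∀ i, f (singleTuple i 1) = scalarEnd k P c (singleTuple i 1) := by
    intro i
    refine Subtype.ext (funext fun t => ?_)
    rw [scalarEnd_apply]
    by_cases hio : i = o
    · rw [hio]
      rcases eq_or_ne t o with ht | ht
      · simp [singleTuple, c, ht]
      -- The pair `(o, t)` itself shows that the entry at `t ≠ o` vanishes; when `k = 1` there is no
      -- such `t`.
      · rw [hfE o t ht.symm]
        simp [singleTuple, ht]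
    · rw [hfE i o hio]
      rcases eq_or_ne t i with rfl | ht
      · simp [singleTuple, c]
      · simp [singleTuple, ht]
  refine ⟨c, AddMonoidHom.ext fun v => ?_⟩
  have hv : v = ∑ s, scalarEnd k P ⟨v.1 s, mem_tuples.1 v.2 s⟩ (singleTuple s 1) := by
    refine Subtype.ext ?_
    rw [AddSubgroup.val_finsetSum]
    conv_lhs => rw [← Finset.univ_sum_single v.1]
    refine Finset.sum_congr rfl fun s _ => funext fun t => ?_
    rw [scalarEnd_apply]
    rcases eq_or_ne t s with rfl | ht
    · simp [singleTuple]
    · simp [singleTuple, ht]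
  have hcomm : ∀ x w, f (scalarEnd k P x w) = scalarEnd k P x (f w) := fun x w =>
    (DFunLike.congr_fun (scalarEnd_comm hP x f) w).symm
  have hcomm' : ∀ x w, scalarEnd k P c (scalarEnd k P x w) =
      scalarEnd k P x (scalarEnd k P c w) := fun x w =>
    (DFunLike.congr_fun (scalarEnd_comm hP x (scalarEnd k P c)) w).symm
  rw [hv]
  refine (map_sum (scalarEnd k P c : tuples k P →+ tuples k P) _ _).trans
    (Eq.trans ?_ (map_sum (f : tuples k P →+ tuples k P) _ _).symm)
  exact Finset.sum_congr rfl fun s _ => ((hcomm' _ _).trans (congrArg _ (hfe s).symm)).trans (hcomm _ _).symm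

/-- The centre of the ring generated by the pure embeddings consists of the scalars. -/
theorem nonempty_center_pureEndRing_equiv (hk : 1 ≤ k) (hP : IsPureSubring P) :
    Nonempty (Subring.center (pureEndRing (tuples k P)) ≃+* P) := by
  let φ : P →+* Subring.center (pureEndRing (tuples k P)) :=
    ((scalarEnd k P).codRestrict _ (scalarEnd_mem_pureEndRing hP)).codRestrict _ fun c =>
      Subring.mem_center_iff.2 fun g => Subtype.ext (scalarEnd_comm hP c g.1).symm
  have hφ : ∀ c, (φ c).1.1 = scalarEnd k P c := fun _ => rfl
  refine ⟨(RingEquiv.ofBijective φ ⟨fun a b hab => ?_, fun f => ?_⟩).symm⟩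
  · have h : scalarEnd k P a = scalarEnd k P b := by rw [← hφ, hab, hφ]
    have h2 := congrFun (congrArg Subtype.val
      (DFunLike.congr_fun h (singleTuple (⟨0, hk⟩ : Fin k) 1))) ⟨0, hk⟩
    rw [scalarEnd_apply, scalarEnd_apply] at h2
    exact Subtype.ext (by simpa [singleTuple] using h2)
  · obtain ⟨c, hc⟩ := exists_eq_scalarEnd hk hP f.1.1 fun g hg =>
      congrArg Subtype.val (Subring.mem_center_iff.1 f.2 ⟨g, hg⟩)
    exact ⟨c, Subtype.ext (Subtype.ext hc)⟩

end Center

/-! ### Invariance under group isomorphism -/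

section Transport

variable {G H : Type*} [AddCommGroup G] [AddCommGroup H]

/-- Conjugation by an isomorphism of groups. -/
def conjEnd (e : G ≃+ H) : AddMonoid.End G ≃+* AddMonoid.End H where
  toFun f := (e.toAddMonoidHom.comp f).comp e.symm.toAddMonoidHom
  invFun f := (e.symm.toAddMonoidHom.comp f).comp e.toAddMonoidHom
  left_inv f := AddMonoidHom.ext fun x => by
    change e.symm (e (f (e.symm (e x)))) = f x
    rw [e.symm_apply_apply, e.symm_apply_apply]
  right_inv f := AddMonoidHom.ext fun x => by
    change e (e.symm (f (e (e.symm x)))) = f x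
    rw [e.apply_symm_apply, e.apply_symm_apply]
  map_mul' f g := AddMonoidHom.ext fun x => by
    change e (f (g (e.symm x))) = e (f (e.symm (e (g (e.symm x)))))
    rw [e.symm_apply_apply]
  map_add' f g := AddMonoidHom.ext fun x => map_add e (f (e.symm x)) (g (e.symm x))

theorem conjEnd_mem_pureEndRing (e : G ≃+ H) {f : AddMonoid.End G} (hf : f ∈ pureEndRing G) :
    conjEnd e f ∈ pureEndRing H := by
  suffices h : pureEndRing G ≤ (pureEndRing H).comap (conjEnd e).toRingHom from h hf
  refine Subring.closure_le.2 ?_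
  rintro f ⟨hf, hpure⟩
  refine Subring.subset_closure ⟨?_, ?_⟩
  · exact (e.injective.comp hf).comp e.symm.injective
  · rintro n _ ⟨x, rfl⟩ ⟨y, hy⟩
    obtain ⟨_, ⟨w, rfl⟩, hz⟩ := hpure n (f (e.symm x)) ⟨e.symm x, rfl⟩
      ⟨e.symm y, by rw [← map_nsmul, hy]; exact e.symm_apply_apply _⟩
    refine ⟨e (f w), ⟨e w, congrArg (e ∘ f) (e.symm_apply_apply w)⟩, ?_⟩
    rw [← map_nsmul]
    exact congrArg e hz

/-- An isomorphism of groups induces an isomorphism of the rings generated by pure embeddings. -/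
def pureEndRingCongr (e : G ≃+ H) : pureEndRing G ≃+* pureEndRing H where
  toFun f := ⟨conjEnd e f.1, conjEnd_mem_pureEndRing e f.2⟩
  invFun f := ⟨conjEnd e.symm f.1, conjEnd_mem_pureEndRing e.symm f.2⟩
  left_inv f := Subtype.ext ((conjEnd e).left_inv f.1)
  right_inv f := Subtype.ext ((conjEnd e).right_inv f.1)
  map_mul' f g := Subtype.ext (map_mul (conjEnd e) f.1 g.1)
  map_add' f g := Subtype.ext (map_add (conjEnd e) f.1 g.1)

end Transport

end SBGroups

namespace SBGroups

/-- Some fraction `a / b` has powers with a common denominator `c`, although no nonzero integer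
multiple of it lies in `R`. -/
def HasBoundedPowers (R : Type*) [CommRing R] : Prop :=
  ∃ a b c : R, b ≠ 0 ∧ c ≠ 0 ∧ (∀ n : ℕ, b ^ n ∣ c * a ^ n) ∧ ∀ m : ℕ, m ≠ 0 → ¬ b ∣ m * a

theorem HasBoundedPowers.of_ringEquiv {R S : Type*} [CommRing R] [CommRing S] (e : R ≃+* S)
    (h : HasBoundedPowers R) : HasBoundedPowers S := by
  obtain ⟨a, b, c, hb, hc, h1, h2⟩ := h
  refine ⟨e a, e b, e c, by simpa using hb, by simpa using hc, fun n => ?_, fun m hm h => ?_⟩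
  · rw [← map_pow, ← map_pow, ← map_mul]
    exact map_dvd e (h1 n)
  · refine h2 m hm ?_
    rwa [← map_natCast e, ← map_mul, map_dvd_iff] at h

/-- The fraction `a / b` is almost integral, hence integral over a Noetherian domain, hence in `R`.
-/
theorem dvd_of_forall_pow_dvd {R : Type*} [CommRing R] [IsDomain R] [IsNoetherianRing R]
    [IsIntegrallyClosed R] {a b c : R} (hb : b ≠ 0) (hc : c ≠ 0)
    (h : ∀ n : ℕ, b ^ n ∣ c * a ^ n) : b ∣ a := by
  let K := FractionRing R
  have hb' : algebraMap R K b ≠ 0 := by simpa using hb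
  have hint : IsAlmostIntegral R (algebraMap R K a / algebraMap R K b) := by
    refine ⟨c, mem_nonZeroDivisors_of_ne_zero hc, fun n => ?_⟩
    obtain ⟨d, hd⟩ := h n
    refine ⟨d, ?_⟩
    rw [Algebra.smul_def, div_pow, mul_div_assoc', eq_div_iff (pow_ne_zero _ hb'), ← map_pow,
      ← map_pow, ← map_mul, ← map_mul, hd, mul_comm]
  obtain ⟨q, hq⟩ := IsIntegrallyClosed.isIntegral_iff.1 hint.isIntegral
  refine ⟨q, IsFractionRing.injective R K ?_⟩
  rw [map_mul, hq, mul_div_cancel₀ _ hb']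

/-! ### Distinguishing the two rings -/

section Rings

variable {p : ℕ} [hp : Fact p.Prime] {γ₁ γ₂ : ℤ_[p]}

open MvPolynomial

/-- Evaluation of rational polynomials at `γ₁`, `γ₂`. -/
noncomputable def evalPair (γ₁ γ₂ : ℤ_[p]) : MvPolynomial (Fin 2) ℚ →ₐ[ℚ] ℚ_[p] :=
  aeval fun i => ((![γ₁, γ₂] i : ℤ_[p]) : ℚ_[p])

theorem evalPair_injective (h : AlgebraicIndependent ℤ ![γ₁, γ₂]) :
    Function.Injective (evalPair γ₁ γ₂) := by
  have h1 := h.map' (f := (algebraMap ℤ_[p] ℚ_[p]).toIntAlgHom)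
    (IsFractionRing.injective ℤ_[p] ℚ_[p])
  have : Algebra.IsAlgebraic ℤ ℚ := IsLocalization.isAlgebraic ℚ (nonZeroDivisors ℤ)
  exact h1.extendScalars ℚ

theorem exists_evalPair_eq {x : ℤ_[p]} (hx : x ∈ ringOne γ₁ γ₂) :
    ∃ q, evalPair γ₁ γ₂ q = x := by
  obtain ⟨n, hn, h⟩ := hx
  have hle : Subring.closure (monomialsOne γ₁ γ₂ : Set ℤ_[p]) ≤
      (evalPair γ₁ γ₂).toRingHom.range.comap (algebraMap ℤ_[p] ℚ_[p]) := by
    refine Subring.closure_le.2 ?_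
    rintro _ ⟨i, j, rfl⟩
    exact ⟨X 0 ^ i * X 1 ^ j, by simp [evalPair]⟩
  obtain ⟨q, hq⟩ := hle h
  refine ⟨C (n : ℚ)⁻¹ * q, ?_⟩
  have hq' : evalPair γ₁ γ₂ q = n * (x : ℚ_[p]) := by
    refine hq.trans ?_
    simp
  have hn' : (n : ℚ_[p]) ≠ 0 := Nat.cast_ne_zero.2 hn
  rw [map_mul, hq', ← algebraMap_eq, AlgHom.commutes]
  simp [hn']

theorem exists_natCast_mul_evalPair (q : MvPolynomial (Fin 2) ℚ) :
    ∃ m : ℕ, m ≠ 0 ∧ ∃ y ∈ ringOne γ₁ γ₂, (m : ℚ_[p]) * evalPair γ₁ γ₂ q = (y : ℚ_[p]) := by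
  induction q using MvPolynomial.induction_on with
  | C r =>
    refine ⟨r.den, r.den_nz, (r.num : ℤ_[p]), intCast_mem _ _, ?_⟩
    rw [← algebraMap_eq, AlgHom.commutes, eq_ratCast, PadicInt.coe_intCast]
    exact_mod_cast congrArg (Rat.cast : ℚ → ℚ_[p]) (Rat.den_mul_eq_num r)
  | add f g hf hg =>
    obtain ⟨m, hm, y, hy, h1⟩ := hf
    obtain ⟨n, hn, z, hz, h2⟩ := hg
    refine ⟨m * n, mul_ne_zero hm hn, n * y + m * z, add_mem (mul_mem (natCast_mem _ _) hy)
      (mul_mem (natCast_mem _ _) hz), ?_⟩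
    push_cast
    rw [← h1, ← h2, map_add]; ring
  | mul_X f i hf =>
    obtain ⟨m, hm, y, hy, h1⟩ := hf
    have hi : (![γ₁, γ₂] i : ℤ_[p]) ∈ ringOne γ₁ γ₂ := by
      refine le_isolator _ (Subring.subset_closure ?_)
      fin_cases i
      · exact ⟨1, 0, by simp⟩
      · exact ⟨0, 1, by simp⟩
    refine ⟨m, hm, y * ![γ₁, γ₂] i, mul_mem hy hi, ?_⟩
    rw [map_mul, ← mul_assoc, h1, PadicInt.coe_mul]
    simp [evalPair]

/-- The divisibilities lift to `ℚ[X, Y]`, where they force `B ∣ A`. Clearing denominators of the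
quotient puts a nonzero integer multiple of `a / b` in the ring. -/
theorem not_hasBoundedPowers_ringOne (h : AlgebraicIndependent ℤ ![γ₁, γ₂]) :
    ¬ HasBoundedPowers (ringOne γ₁ γ₂) := by
  rintro ⟨a, b, c, hb, hc, h1, h2⟩
  obtain ⟨A, hA⟩ := exists_evalPair_eq a.2
  obtain ⟨B, hB⟩ := exists_evalPair_eq b.2
  obtain ⟨D, hD⟩ := exists_evalPair_eq c.2
  have hdvd : B ∣ A := by
    refine dvd_of_forall_pow_dvd (c := D) ?_ ?_ fun n => ?_
    · rintro rfl
      rw [map_zero, eq_comm, PadicInt.coe_eq_zero] at hB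
      exact hb (Subtype.ext hB)
    · rintro rfl
      rw [map_zero, eq_comm, PadicInt.coe_eq_zero] at hD
      exact hc (Subtype.ext hD)
    · obtain ⟨d, hd⟩ := h1 n
      obtain ⟨E, hE⟩ := exists_evalPair_eq d.2
      refine ⟨E, evalPair_injective h ?_⟩
      rw [map_mul, map_mul, map_pow, map_pow, hA, hB, hD, hE]
      exact_mod_cast congrArg (fun x : ringOne γ₁ γ₂ => ((x : ℤ_[p]) : ℚ_[p])) hd
  obtain ⟨q, rfl⟩ := hdvd
  obtain ⟨m, hm, y, hy, hmy⟩ := exists_natCast_mul_evalPair (γ₁ := γ₁) (γ₂ := γ₂) q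
  refine h2 m hm ⟨⟨y, hy⟩, Subtype.ext (PadicInt.ext ?_)⟩
  push_cast
  rw [← hmy, ← hA, map_mul, hB]; ring

/-- Polynomials spanned by the allowed monomials have zero coefficient at the second variable, and
algebraic independence makes the representing polynomial unique. -/
theorem natCast_mul_notMem_closure_monomialsTwo (h : AlgebraicIndependent ℤ ![γ₁, γ₂]) {n : ℕ}
    (hn : n ≠ 0) : (n : ℤ_[p]) * γ₂ ∉ Subring.closure (monomialsTwo γ₁ γ₂ : Set ℤ_[p]) := by
  intro hmem
  rw [Subring.mem_closure_iff, Submonoid.closure_eq] at hmem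
  have hcoeff : ∀ x ∈ AddSubgroup.closure (monomialsTwo γ₁ γ₂ : Set ℤ_[p]),
      ∃ q : MvPolynomial (Fin 2) ℤ, aeval ![γ₁, γ₂] q = x ∧ coeff (Finsupp.single 1 1) q = 0 := by
    intro x hx
    induction hx using AddSubgroup.closure_induction with
    | mem x hx =>
      rcases hx with ⟨i, j, hi, rfl⟩ | rfl
      · refine ⟨X 0 ^ i * X 1 ^ j, by simp, ?_⟩
        rw [X_pow_eq_monomial, X_pow_eq_monomial, monomial_mul, coeff_monomial, if_neg]
        intro h0
        have := DFunLike.congr_fun h0 0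
        simp at this
        omega
      · refine ⟨1, by simp, ?_⟩
        rw [coeff_one, if_neg]
        intro h0
        simpa using DFunLike.congr_fun h0 1
    | zero => exact ⟨0, by simp, by simp⟩
    | add x y _ _ hx hy =>
      obtain ⟨q, rfl, hq⟩ := hx
      obtain ⟨r, rfl, hr⟩ := hy
      exact ⟨q + r, by simp, by rw [coeff_add, hq, hr, add_zero]⟩
    | neg x _ hx =>
      obtain ⟨q, rfl, hq⟩ := hx
      exact ⟨-q, by simp, by rw [coeff_neg, hq, neg_zero]⟩
  obtain ⟨q, hq, hq0⟩ := hcoeff _ hmem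
  have hq' : q = C (n : ℤ) * X 1 := by
    apply h
    rw [hq, map_mul, ← algebraMap_eq, AlgHom.commutes]
    simp
  rw [hq', coeff_C_mul, coeff_X, if_pos rfl, mul_one] at hq0
  exact hn (by exact_mod_cast hq0)

theorem hasBoundedPowers_ringTwo (h : AlgebraicIndependent ℤ ![γ₁, γ₂]) :
    HasBoundedPowers (ringTwo γ₁ γ₂) := by
  have h0 : γ₁ ≠ 0 := h.ne_zero 0
  have hmem : ∀ j, γ₁ * γ₂ ^ j ∈ ringTwo γ₁ γ₂ := fun j =>
    mul_mem_ringTwo (le_isolator _ (Subring.subset_closure ⟨0, j, by simp⟩))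
  let g : ringTwo γ₁ γ₂ := ⟨γ₁, by simpa using hmem 0⟩
  have hg : g ≠ 0 := fun hg => h0 (congrArg Subtype.val hg)
  refine ⟨⟨γ₁ * γ₂, by simpa using hmem 1⟩, g, g, hg, hg, fun n => ?_, ?_⟩
  · refine ⟨⟨γ₁ * γ₂ ^ n, hmem n⟩, Subtype.ext ?_⟩
    simp only [g, Subring.coe_mul, Subring.coe_pow]
    ring
  · rintro m hm ⟨y, hy⟩
    have hy' : (y : ℤ_[p]) = m * γ₂ := by
      refine mul_left_cancel₀ h0 ?_
      have := congrArg Subtype.val hy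
      push_cast at this
      rw [← this]; ring
    obtain ⟨n, hn, h3⟩ := y.2
    rw [hy', ← mul_assoc, ← Nat.cast_mul] at h3
    exact natCast_mul_notMem_closure_monomialsTwo h (mul_ne_zero hn hm) h3

theorem isEmpty_ringOne_equiv_ringTwo (h : AlgebraicIndependent ℤ ![γ₁, γ₂]) :
    IsEmpty (ringOne γ₁ γ₂ ≃+* ringTwo γ₁ γ₂) :=
  ⟨fun e => not_hasBoundedPowers_ringOne h ((hasBoundedPowers_ringTwo h).of_ringEquiv e.symm)⟩

end Rings

/-! ### Existence of independent units -/

section Existence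

open Cardinal

variable {p : ℕ} [hp : Fact p.Prime]

theorem aleph0_lt_mk_padicInt : ℵ₀ < #ℤ_[p] := by
  have h := continuum_le_cardinal_of_isOpen ℚ_[p] (PadicInt.isOpenEmbedding_coe (p := p)).isOpen_range
    ⟨0, (0 : ℤ_[p]), rfl⟩
  exact aleph0_lt_continuum.trans_le (h.trans mk_range_le)

/-- An algebraic extension of a countable domain is countable, but `ℤ_p` is not. A transcendental
nonunit `x` is replaced by the unit `1 - x`. -/
theorem exists_unit_transcendental (R : Type) [CommRing R] [IsDomain R]
    [Algebra R ℤ_[p] ] [Module.IsTorsionFree R ℤ_[p] ] (hR : #R ≤ ℵ₀) :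
    ∃ x : ℤ_[p], IsUnit x ∧ Transcendental R x := by
  have h : ∃ x : ℤ_[p], Transcendental R x := by
    by_contra! h
    have : Algebra.IsAlgebraic R ℤ_[p] := ⟨fun x => by simpa [Transcendental] using h x⟩
    have h2 := Algebra.IsAlgebraic.cardinalMk_le_max R ℤ_[p]
    rw [max_eq_right hR] at h2
    exact aleph0_lt_mk_padicInt.not_ge h2
  obtain ⟨x, hx⟩ := h
  rcases IsLocalRing.isUnit_or_isUnit_one_sub_self x with h1 | h1
  · exact ⟨x, h1, hx⟩
  · refine ⟨1 - x, h1, fun h2 => hx ?_⟩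
    simpa using isAlgebraic_one.sub h2

theorem exists_isIndepUnitPair : ∃ γ₁ γ₂ : ℤ_[p], IsIndepUnitPair γ₁ γ₂ := by
  obtain ⟨y, hy, hyt⟩ := exists_unit_transcendental (p := p) ℤ mk_le_aleph0
  have hyi : AlgebraicIndependent ℤ ![y] := algebraicIndependent_iff_transcendental.2 hyt
  have hadj : #(Algebra.adjoin ℤ (Set.range ![y])) ≤ ℵ₀ := by
    rw [Algebra.adjoin_range_eq_range_aeval]
    refine (mk_le_of_surjective (AlgHom.rangeRestrict_surjective _)).trans ?_
    exact MvPolynomial.cardinalMk_le_max_lift.trans (by simp)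
  obtain ⟨x, hx, hxt⟩ := exists_unit_transcendental (p := p) _ hadj
  refine ⟨x, y, hx, hy, ?_⟩
  have := ((hyi.option_iff_transcendental x).2 hxt).comp (finSuccEquiv 1) (finSuccEquiv 1).injective
  convert this using 1
  funext i
  fin_cases i <;> rfl

end Existence

end SBGroups

/-! ### Assembling the counterexample -/

namespace SBGroups

variable {p : ℕ} [hp : Fact p.Prime]

theorem isEmpty_center_equiv_of_isEmpty_equiv {k : ℕ} (hk : 1 ≤ k) {P Q : Subring ℤ_[p]}
    (hP : IsPureSubring P) (hQ : IsPureSubring Q) (h : IsEmpty (P ≃+* Q)) :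
    IsEmpty (Subring.center (pureEndRing (tuples k P)) ≃+*
      Subring.center (pureEndRing (tuples k Q))) := by
  obtain ⟨e⟩ := nonempty_center_pureEndRing_equiv hk hP
  obtain ⟨e'⟩ := nonempty_center_pureEndRing_equiv hk hQ
  exact ⟨fun f => h.false ((e.symm.trans f).trans e')⟩

theorem isEmpty_plusEquiv_of_isEmpty_center_equiv {G H : Type*} [AddCommGroup G] [AddCommGroup H]
    (h : IsEmpty (Subring.center (pureEndRing G) ≃+* Subring.center (pureEndRing H))) :
    IsEmpty (G ≃[plusLang] H) :=
  ⟨fun e => h.false (Subring.centerCongr (pureEndRingCongr (addEquivOfPlusEquiv e)))⟩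

theorem isEmpty_center_hull_equiv {k : ℕ} (hk : 1 ≤ k) {γ₁ γ₂ : ℤ_[p]}
    (h : IsIndepUnitPair γ₁ γ₂) :
    IsEmpty (Subring.center (pureEndRing (hullOne k γ₁ γ₂)) ≃+*
      Subring.center (pureEndRing (hullTwo k γ₁ γ₂))) := by
  rw [hullOne_eq_tuples, hullTwo_eq_tuples]
  exact isEmpty_center_equiv_of_isEmpty_equiv hk (isPureSubring_isolator _)
    (isPureSubring_isolator _) (isEmpty_ringOne_equiv_ringTwo h.2.2)

theorem isSBCounterexample_hull {k : ℕ} (hk : 1 ≤ k) {γ₁ γ₂ : ℤ_[p]}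
    (h : IsIndepUnitPair γ₁ γ₂) :
    IsSBCounterexample (thZLoc p k) (hullOne k γ₁ γ₂) (hullTwo k γ₁ γ₂) := by
  have hiso := isEmpty_plusEquiv_of_isEmpty_center_equiv (isEmpty_center_hull_equiv hk h)
  rw [hullOne_eq_tuples, hullTwo_eq_tuples] at hiso ⊢
  have h1 : IsPureSubring (ringOne γ₁ γ₂) := isPureSubring_isolator _
  have h2 : IsPureSubring (ringTwo γ₁ γ₂) := isPureSubring_isolator _
  obtain ⟨u, hu⟩ := h.1
  exact ⟨tuples_models_thZLoc hk h1, tuples_models_thZLoc hk h2,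
    nonempty_elementaryEmbedding_tuples hk h1 h2 u fun x hx => by
      rw [hu]; exact mul_mem_ringTwo hx,
    nonempty_elementaryEmbedding_tuples hk h2 h1 1 fun x hx => by
      simpa using ringTwo_le_ringOne _ _ hx, hiso⟩

end SBGroups

theorem mainTheorem3 (p : ℕ) [Fact p.Prime] (k : ℕ) (hk : 1 ≤ k) :
    ¬ SBGroups.HasSB (SBGroups.thZLoc p k) ∧
    (∃ (A B : Type) (_ : AddCommGroup A) (_ : AddCommGroup B),
      SBGroups.IsReducedGroup A ∧ SBGroups.IsReducedGroup B ∧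
      SBGroups.IsSBCounterexample (SBGroups.thZLoc p k) A B) ∧
    (∃ γ₁ γ₂ : ℤ_[p], SBGroups.IsIndepUnitPair γ₁ γ₂) ∧
    (∀ γ₁ γ₂ : ℤ_[p], SBGroups.IsIndepUnitPair γ₁ γ₂ →
      SBGroups.IsReducedGroup (SBGroups.hullOne k γ₁ γ₂) ∧
      SBGroups.IsReducedGroup (SBGroups.hullTwo k γ₁ γ₂) ∧
      SBGroups.IsSBCounterexample (SBGroups.thZLoc p k)
        (SBGroups.hullOne k γ₁ γ₂) (SBGroups.hullTwo k γ₁ γ₂) ∧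
      IsEmpty
        (Subring.center (SBGroups.pureEndRing (SBGroups.hullOne k γ₁ γ₂)) ≃+*
          Subring.center (SBGroups.pureEndRing (SBGroups.hullTwo k γ₁ γ₂)))) := by
  obtain ⟨γ₁, γ₂, hγ⟩ := SBGroups.exists_isIndepUnitPair (p := p)
  have h := SBGroups.isSBCounterexample_hull hk hγ
  refine ⟨fun hSB => ?_, ⟨_, _, inferInstance, inferInstance, SBGroups.isReducedGroup_of_padic _,
    SBGroups.isReducedGroup_of_padic _, h⟩, ⟨γ₁, γ₂, hγ⟩, fun γ₁ γ₂ hγ =>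
    ⟨SBGroups.isReducedGroup_of_padic _, SBGroups.isReducedGroup_of_padic _,
      SBGroups.isSBCounterexample_hull hk hγ, SBGroups.isEmpty_center_hull_equiv hk hγ⟩⟩
  obtain ⟨e⟩ := hSB _ _ h.left_model h.right_model h.left_to_right h.right_to_left
  exact h.not_iso.false e
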